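/- **Data.** Let $T,n,m_1,m_2$ be positive integers. For $j\in[T]$ let $\bar x_i^{(j)}\in\mathbb R^n$, $\bar y_i^{(j)}\in\{\pm1\}$ $(i\in[m_1])$ be validation data and $\hat x_i^{(j)}\in\mathbb R^n$, $\hat y_i^{(j)}\in\{\pm1\}$ $(i\in[m_2])$ training data. Let $X\in\mathbb R^{Tn\times Tm_2}$ be block diagonal with blocks $[\hat x_1^{(j)},\dots,\hat x_{m_2}^{(j)}]$, let $A\in\mathbb R^{Tm_1\times Tn}$ be block diagonal, its $j$-th block having the rows $\bar y_i^{(j)}(\bar x_i^{(j)})^\top$, and let $\hat y\in\mathbb R^{Tm_2}$ be the stacked training labels. With functions of vectors taken entrywise, put for $w\in\mathbb R^{Tn}$ $$f(w)=\mathbf 1^\top\log(\mathbf 1+e^{-Aw}),\qquad g(w)=\tfrac12X\Big(\frac{1-e^{-X^\top w}}{1+e^{-X^\top w}}-\hat y\Big),$$ so that $\nabla f(w)=-A^\top(1+e^{Aw})^{-1}$ and $\nabla g(w)=X\,\mathrm{Diag}(u(w))X^\top$ with $u(w)=(2+e^{-X^\top w}+e^{X^\top w})^{-1}$. For $v=(C,w)\in\mathbb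 R\times\mathbb R^{Tn}$ and $\mu\in\mathbb R^{Tn}$ put $P(v)=I+C\nabla g(w)$, $$\alpha(\mu,v)=\tfrac1{Tm_1}A^\top\mathrm{Diag}\Big(\frac{e^{Aw}}{(1+e^{Aw})^2}\Big)A+C\,X\,\mathrm{Diag}(X^\top\mu)\,\mathrm{Diag}\Big(\frac{e^{-X^\top w}(e^{-X^\top w}-1)}{(1+e^{-X^\top w})^3}\Big)X^\top,$$ $$z(\mu,v)=g(w)^\top P(v)^{-1}\big(\alpha(\mu,v)P(v)^{-1}g(w)-2\nabla g(w)\mu\big)\quad\text{whenever } P(v)\text{ is invertible.}$$ **Smoothing system.** Let $h(\epsilon,t)$ be the Huber function: $h(0,t)=\max\{0,t\}$, and for $\epsilon\ne0$, $h=t-|\epsilon|/2$ if $t>|\epsilon|$, $h=t^2/(2|\epsilon|)$ if $0\le t\le|\epsilon|$, $h=0$ if $t<0$. For a constant $\kappa>0$ let $\hat{\mathcal E}=(\epsilon,\mathcal E)$ with $$\mathcal E(\epsilon,C,\mu,w)=\begin{bmatrix}(1+\kappa|\epsilon|)C-h(\epsilon,C-\mu^\top g(w))\\ \frac1{Tm_1}\nabla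 f(w)+P(v)\mu\\ w+Cg(w)\end{bmatrix},$$ and let $\psi=\|\hat{\mathcal E}\|^2$, with Euclidean norms. **Algorithm SN.** Parameters: $\hat\epsilon>0$, $r\in(0,1)$, $\hat\eta>0$ with $\delta:=\sqrt2\max\{r\hat\epsilon,\hat\eta\}<1$, $\hat r>0$, $\rho\in(0,1)$, $\sigma\in(0,\frac12)$, $\tau\in(0,1]$. Starting point: $b^0=(\epsilon^0,C^0,\mu^0,w^0)$ with $\epsilon^0>0$. At $b^k=(\epsilon^k,C^k,\mu^k,w^k)$: stop if $\hat{\mathcal E}(b^k)=0$. Otherwise let $\eta_k=\min\{1,\hat r\|\hat{\mathcal E}(b^k)\|^\tau\}$ and $\zeta_k=r\min\{1,\|\hat{\mathcal E}(b^k)\|^{1+\tau}\}$; compute an admissible direction, that is, any $\Delta b^k=(\Delta\epsilon^k,\Delta C^k,\Delta\mu^k,\Delta w^k)$ with $\Delta\epsilon^k=-\epsilon^k+\zeta_k\hat\epsilon$ whose residual $\mathcal R_k=\mathcal E(b^k)+J_{\mathcal E}(b^k)\Delta b^k$ satisfies $$\|\mathcal R_k\|\le\eta_k\|\mathcal E(b^k)+\nabla_\epsilon\mathcal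 E(b^k)\Delta\epsilon^k\|,\qquad \|\mathcal R_k\|\le\hat\eta\|\hat{\mathcal E}(b^k)\|;$$ let $\ell_k$ be the smallest integer $\ell\ge0$ with $\psi(b^k+\rho^\ell\Delta b^k)\le[1-2\sigma(1-\delta)\rho^\ell]\psi(b^k)$; set $b^{k+1}=b^k+\rho^{\ell_k}\Delta b^k$. A point is called an iterate of SN if some run from $b^0$ (with some admissible choice of the directions) reaches it. Call a point regular if $P(v)$ is invertible and $z(\mu,v)>-\kappa\epsilon$. **Theorem.** 1. (Well-definedness.) At every iterate $b=(\epsilon,C,\mu,w)$ of SN: $\epsilon>0$ and $\hat{\mathcal E}(b)\ne0$ (so the stopping test fails); $\hat{\mathcal E}$ is differentiable at $b$; if $b$ is regular, then $J_{\hat{\mathcal E}}(b)$ is nonsingular and an admissible direction exists; and for every admissible direction the line search ends, i.e. the smallest $\ell$ exists. 2. (Infinite sequence.) If all iterates of SN from $b^0$ are regular, then every finite run of SN from $b^0$ extends to an infinite one; in particular SN generates an infinite sequence. 3. (Global convergence.) Let $(b^k)_{k\ge0}$ be any infinite sequence generated by SN from $b^0$. Every accumulation point $(\bar\epsilon,\bar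 C,\bar\mu,\bar w)$ of it at which $P(\bar v)$, $\bar v=(\bar C,\bar w)$, is invertible and $z(\bar\mu,\bar v)>0$ satisfies $\hat{\mathcal E}(\bar\epsilon,\bar C,\bar\mu,\bar w)=0$, and in particular $\bar\epsilon=0$. -/

import Mathlib

open scoped Matrix
open Filter Topology

noncomputable section

/-- Data of `T`-fold cross validation in `ℝⁿ`: validation points `xbar j i` with labels `ybar j i`
(`m₁` per fold) and training points `xhat j i` with labels `yhat j i` (`m₂` per fold). -/
structure CVData (T n m₁ m₂ : ℕ) where
  xbar : Fin T → Fin m₁ → Fin n → ℝ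
  ybar : Fin T → Fin m₁ → ℝ
  xhat : Fin T → Fin m₂ → Fin n → ℝ
  yhat : Fin T → Fin m₂ → ℝ
  ybar_label : ∀ j i, ybar j i = 1 ∨ ybar j i = -1
  yhat_label : ∀ j i, yhat j i = 1 ∨ yhat j i = -1

namespace CVData

variable {T n m₁ m₂ : ℕ} (D : CVData T n m₁ m₂)

/-- Block diagonal `X`, the `j`-th block having the columns `xhat j i`. -/
def X : Matrix (Fin T × Fin n) (Fin T × Fin m₂) ℝ :=
  Matrix.of fun a i => if a.1 = i.1 then D.xhat i.1 i.2 a.2 else 0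

/-- Block diagonal `A`, the `j`-th block having the rows `ybar j i • xbar j i`. -/
def A : Matrix (Fin T × Fin m₁) (Fin T × Fin n) ℝ :=
  Matrix.of fun i a => if i.1 = a.1 then D.ybar i.1 i.2 * D.xbar i.1 i.2 a.2 else 0

/-- The stacked training labels. -/
def y (i : Fin T × Fin m₂) : ℝ := D.yhat i.1 i.2

/-- `h_X(w)`, with entries `(1 - exp (-xᵀw)) / (1 + exp (-xᵀw))`. -/
def hX (w : Fin T × Fin n → ℝ) (i : Fin T × Fin m₂) : ℝ :=
  (1 - Real.exp (-(D.Xᵀ *ᵥ w) i)) / (1 + Real.exp (-(D.Xᵀ *ᵥ w) i))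

/-- `f(w) = 1ᵀ log (1 + exp (-A w))`. -/
def f (w : Fin T × Fin n → ℝ) : ℝ :=
  ∑ i, Real.log (1 + Real.exp (-(D.A *ᵥ w) i))

/-- `g(w) = ½ X (h_X(w) - ŷ)`. -/
def g (w : Fin T × Fin n → ℝ) : Fin T × Fin n → ℝ :=
  (1 / 2 : ℝ) • (D.X *ᵥ (D.hX w - D.y))

def s (w : Fin T × Fin n → ℝ) (i : Fin T × Fin m₁) : ℝ :=
  (1 + Real.exp ((D.A *ᵥ w) i))⁻¹

def u (w : Fin T × Fin n → ℝ) (i : Fin T × Fin m₂) : ℝ :=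
  (2 + Real.exp (-(D.Xᵀ *ᵥ w) i) + Real.exp ((D.Xᵀ *ᵥ w) i))⁻¹

def p (w : Fin T × Fin n → ℝ) (i : Fin T × Fin m₁) : ℝ :=
  Real.exp ((D.A *ᵥ w) i) / (1 + Real.exp ((D.A *ᵥ w) i)) ^ 2

def q (w : Fin T × Fin n → ℝ) (i : Fin T × Fin m₂) : ℝ :=
  Real.exp (-(D.Xᵀ *ᵥ w) i) * (Real.exp (-(D.Xᵀ *ᵥ w) i) - 1) /
    (1 + Real.exp (-(D.Xᵀ *ᵥ w) i)) ^ 3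

/-- `∇f(w) = -Aᵀ s(w)`. -/
def gradF (w : Fin T × Fin n → ℝ) : Fin T × Fin n → ℝ := -(D.Aᵀ *ᵥ D.s w)

/-- `∇g(w) = X Diag(u(w)) Xᵀ`. -/
def gradG (w : Fin T × Fin n → ℝ) : Matrix (Fin T × Fin n) (Fin T × Fin n) ℝ :=
  D.X * Matrix.diagonal (D.u w) * D.Xᵀ

/-- `gradF` is the gradient of `f`. -/
theorem hasFDerivAt_f (w : Fin T × Fin n → ℝ) :
    HasFDerivAt D.f (dotProductBilin ℝ ℝ (D.gradF w)).toContinuousLinearMap w := by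
  have hA : ∀ i, HasFDerivAt (fun w : Fin T × Fin n → ℝ => (D.A *ᵥ w) i)
      ((LinearMap.proj i ∘ₗ Matrix.mulVecLin D.A).toContinuousLinearMap) w := fun i =>
    (LinearMap.proj i ∘ₗ Matrix.mulVecLin D.A).toContinuousLinearMap.hasFDerivAt
  have h := HasFDerivAt.fun_sum (u := Finset.univ) fun i _ =>
    (((hA i).neg.exp.const_add 1).log (by positivity))
  refine h.congr_fderiv ?_
  refine ContinuousLinearMap.ext fun d => ?_
  simp only [gradF, Matrix.mulVec_transpose, dotProductBilin_apply_apply,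
    LinearMap.coe_toContinuousLinearMap', neg_dotProduct, ← Matrix.dotProduct_mulVec]
  simp only [dotProduct, s, _root_.sum_apply, _root_.smul_apply, _root_.neg_apply, Pi.neg_apply,
    LinearMap.coe_toContinuousLinearMap', smul_eq_mul,
    LinearMap.comp_apply, LinearMap.proj_apply, Matrix.mulVecLin_apply,
    ← Finset.sum_neg_distrib]
  refine Finset.sum_congr rfl fun i _ => ?_
  have hp : 0 < Real.exp ((D.A *ᵥ w) i) := Real.exp_pos _
  rw [Real.exp_neg]
  field_simp
  ring

/-- `gradG` is the Jacobian matrix of `g`. -/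
theorem hasFDerivAt_g (w : Fin T × Fin n → ℝ) :
    HasFDerivAt D.g (Matrix.mulVecLin (D.gradG w)).toContinuousLinearMap w := by
  have hX : ∀ i, HasFDerivAt (fun w : Fin T × Fin n → ℝ => (D.Xᵀ *ᵥ w) i)
      ((LinearMap.proj i ∘ₗ Matrix.mulVecLin D.Xᵀ).toContinuousLinearMap) w := fun i =>
    (LinearMap.proj i ∘ₗ Matrix.mulVecLin D.Xᵀ).toContinuousLinearMap.hasFDerivAt
  have h1 : HasFDerivAt (fun w => D.hX w - D.y)
      ((Matrix.mulVecLin ((2 : ℝ) • (Matrix.diagonal (D.u w) * D.Xᵀ))).toContinuousLinearMap)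
      w := by
    refine HasFDerivAt.sub_const _ ?_
    rw [hasFDerivAt_pi']
    intro i
    have hd : ∀ x : ℝ, HasDerivAt (fun x => (1 - Real.exp (-x)) / (1 + Real.exp (-x)))
        (2 * (2 + Real.exp (-x) + Real.exp x)⁻¹) x := by
      intro x
      have he := (hasDerivAt_neg x).exp
      have hp : 0 < Real.exp x := Real.exp_pos x
      refine ((he.const_sub 1).div (he.const_add 1) (by positivity)).congr_deriv ?_
      rw [Real.exp_neg]
      field_simp
      ring
    refine ((hd _).comp_hasFDerivAt w (hX i)).congr_fderiv ?_
    refine ContinuousLinearMap.ext fun d => ?_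
    simp [← Matrix.mulVec_mulVec, Matrix.mulVec_diagonal, u, mul_assoc]
  have h2 := ((Matrix.mulVecLin D.X).toContinuousLinearMap.hasFDerivAt.comp w h1).const_smul
    (1 / 2 : ℝ)
  refine h2.congr_fderiv ?_
  refine ContinuousLinearMap.ext fun d => ?_
  simp [gradG, Matrix.mulVec_smul, ← Matrix.mulVec_mulVec]

/-- `P(v) = I + C ∇g(w)` for `v = (C, w)`. -/
def P (C : ℝ) (w : Fin T × Fin n → ℝ) : Matrix (Fin T × Fin n) (Fin T × Fin n) ℝ :=
  1 + C • D.gradG w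

/-- `α(μ, v) = (1/(T m₁)) Aᵀ Diag(p(w)) A + C X Diag(Xᵀ μ) Diag(q(w)) Xᵀ`. -/
def alpha (μ : Fin T × Fin n → ℝ) (C : ℝ) (w : Fin T × Fin n → ℝ) :
    Matrix (Fin T × Fin n) (Fin T × Fin n) ℝ :=
  (1 / ((T : ℝ) * m₁)) • (D.Aᵀ * Matrix.diagonal (D.p w) * D.A) +
    C • (D.X * Matrix.diagonal (D.Xᵀ *ᵥ μ) * Matrix.diagonal (D.q w) * D.Xᵀ)

/-- `z(μ, v) = g(w)ᵀ P(v)⁻¹ (α(μ, v) P(v)⁻¹ g(w) - 2 ∇g(w) μ)`. It has its intended meaning when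
`P(v)` is invertible; otherwise the inverse is `0` by convention and so is `z`. -/
def z (μ : Fin T × Fin n → ℝ) (C : ℝ) (w : Fin T × Fin n → ℝ) : ℝ :=
  D.g w ⬝ᵥ ((D.P C w)⁻¹ *ᵥ
    (D.alpha μ C w *ᵥ ((D.P C w)⁻¹ *ᵥ D.g w) - (2 : ℝ) • (D.gradG w *ᵥ μ)))

end CVData

/-- The Huber smoothing function of `max {0, t}`. -/
def huber (ε t : ℝ) : ℝ :=
  if ε = 0 then max 0 t
  else if |ε| < t then t - |ε| / 2
  else if 0 ≤ t then t ^ 2 / (2 * |ε|)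
  else 0

/-- The space of the values of `𝓔`: `ℝ × ℝ^{Tn} × ℝ^{Tn}` with the Euclidean norm. -/
abbrev SNRes (T n : ℕ) : Type :=
  EuclideanSpace ℝ (Unit ⊕ ((Fin T × Fin n) ⊕ (Fin T × Fin n)))

/-- The space of the points `(ε, C, μ, w) ∈ ℝ × ℝ × ℝ^{Tn} × ℝ^{Tn}`, with the Euclidean norm. -/
abbrev SNPoint (T n : ℕ) : Type :=
  EuclideanSpace ℝ (Unit ⊕ (Unit ⊕ ((Fin T × Fin n) ⊕ (Fin T × Fin n))))

namespace SNPoint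

variable {T n : ℕ}

def eps (b : SNPoint T n) : ℝ := b (Sum.inl ())

def C (b : SNPoint T n) : ℝ := b (Sum.inr (Sum.inl ()))

def mu (b : SNPoint T n) (a : Fin T × Fin n) : ℝ := b (Sum.inr (Sum.inr (Sum.inl a)))

def w (b : SNPoint T n) (a : Fin T × Fin n) : ℝ := b (Sum.inr (Sum.inr (Sum.inr a)))

end SNPoint

/-- The parameters of the squared smoothing Newton method (SN), together with the constant `κ`
of the smoothing system. -/
structure SNParams where
  κ : ℝ
  epsHat : ℝ
  r : ℝ
  etaHat : ℝ
  rHat : ℝ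
  ρ : ℝ
  σ : ℝ
  τ : ℝ
  κ_pos : 0 < κ
  epsHat_pos : 0 < epsHat
  r_mem : r ∈ Set.Ioo (0 : ℝ) 1
  etaHat_pos : 0 < etaHat
  delta_lt_one : √2 * max (r * epsHat) etaHat < 1
  rHat_pos : 0 < rHat
  ρ_mem : ρ ∈ Set.Ioo (0 : ℝ) 1
  σ_mem : σ ∈ Set.Ioo (0 : ℝ) (1 / 2)
  τ_mem : τ ∈ Set.Ioc (0 : ℝ) 1

namespace SNParams

/-- `δ = √2 max {r ε̂, η̂}`. -/
def delta (S : SNParams) : ℝ := √2 * max (S.r * S.epsHat) S.etaHat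

end SNParams

namespace CVData

variable {T n m₁ m₂ : ℕ} (D : CVData T n m₁ m₂) (S : SNParams)

/-- The map `𝓔(ε, C, μ, w)`. -/
def smoothE (b : SNPoint T n) : SNRes T n :=
  WithLp.toLp 2 <| Sum.elim
    (fun _ => (1 + S.κ * |b.eps|) * b.C - huber b.eps (b.C - b.mu ⬝ᵥ D.g b.w))
    (Sum.elim
      ((1 / ((T : ℝ) * m₁)) • D.gradF b.w + D.P b.C b.w *ᵥ b.mu)
      (b.w + b.C • D.g b.w))

/-- The smoothing system `Ê = (ε, 𝓔)`. -/
def smoothEHat (b : SNPoint T n) : SNPoint T n :=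
  WithLp.toLp 2 <| Sum.elim (fun _ => b.eps) (D.smoothE S b)

/-- The merit function `ψ = ‖Ê‖²`. -/
def merit (b : SNPoint T n) : ℝ := ‖D.smoothEHat S b‖ ^ 2

/-- `η = min {1, r̂ ‖Ê‖^τ}`. -/
def eta (b : SNPoint T n) : ℝ := min 1 (S.rHat * ‖D.smoothEHat S b‖ ^ S.τ)

/-- `ζ = r min {1, ‖Ê‖^(1+τ)}`. -/
def zeta (b : SNPoint T n) : ℝ := S.r * min 1 (‖D.smoothEHat S b‖ ^ (1 + S.τ))

/-- The residual `𝓡 = 𝓔(b) + 𝓔'(b) Δ` of the linear system in the components after the first. -/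
def residual (b Δ : SNPoint T n) : SNRes T n :=
  D.smoothE S b + fderiv ℝ (D.smoothE S) b Δ

/-- The partial derivative `∇_ε 𝓔(b)`. -/
def dEps (b : SNPoint T n) : SNRes T n :=
  fderiv ℝ (D.smoothE S) b (EuclideanSpace.single (Sum.inl ()) 1)

/-- `Δ` is an admissible approximate solution of the Newton system
`Ê(b) + Ê'(b) Δ = (ζ ε̂, 0, 0, 0)`: the first equation holds exactly and the residual of the
remaining ones meets both tolerances. -/
def IsSNDirection (b Δ : SNPoint T n) : Prop :=
  Δ.eps = -b.eps + D.zeta S b * S.epsHat ∧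
  ‖D.residual S b Δ‖ ≤ D.eta S b * ‖D.smoothE S b + Δ.eps • D.dEps S b‖ ∧
  ‖D.residual S b Δ‖ ≤ S.etaHat * ‖D.smoothEHat S b‖

/-- `l` is the smallest nonnegative integer accepted by the line search from `b` along `Δ`. -/
def IsSNStepSize (b Δ : SNPoint T n) (l : ℕ) : Prop :=
  IsLeast {l : ℕ | D.merit S (b + S.ρ ^ l • Δ) ≤
    (1 - 2 * S.σ * (1 - S.delta) * S.ρ ^ l) * D.merit S b} l

/-- One iteration of SN leads from `b`, where the stopping test fails, to `b₁`. -/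
def SNStep (b b₁ : SNPoint T n) : Prop :=
  D.smoothEHat S b ≠ 0 ∧
  ∃ (Δ : SNPoint T n) (l : ℕ),
    D.IsSNDirection S b Δ ∧ D.IsSNStepSize S b Δ l ∧ b₁ = b + S.ρ ^ l • Δ

/-- `b` is an iterate of some run of SN from `b₀`. -/
def SNReachable (b₀ b : SNPoint T n) : Prop :=
  Relation.ReflTransGen (D.SNStep S) b₀ b

/-- `s` is an infinite sequence of iterates generated by SN from `b₀`. -/
def IsSNSequence (b₀ : SNPoint T n) (s : ℕ → SNPoint T n) : Prop :=
  s 0 = b₀ ∧ ∀ k, D.SNStep S (s k) (s (k + 1))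

/-- The nonsingularity condition `z(μ, v) > -κ ε` (with `P(v)` invertible, so that `z` is
defined). -/
def SNRegular (b : SNPoint T n) : Prop :=
  IsUnit (D.P b.C b.w).det ∧ -(S.κ * b.eps) < D.z b.mu b.C b.w

end CVData

end

/-!
For `ε ≠ 0` the Huber function equals `(t₊² - (t - |ε|)₊²) / (2 |ε|)`, so it is `C¹` there with
slope in `t` between `0` and `1`, and the smoothing system `Ê` is `C¹` (`contDiffAt_smoothEHat`).
Since `|h(ε, t) - t₊| ≤ |ε|`, `Ê` is continuous everywhere (`continuous_smoothEHat`).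

*Nonsingularity.* A vector in the kernel of the Jacobian has `Δε = 0`; the last two blocks of
equations give `Δw = -ΔC P⁻¹ g` and `Δμ = ΔC P⁻¹ (α P⁻¹ g - ∇g μ)`, and the remaining equation
becomes `((1 - c) + κ ε + c z) ΔC = 0` with `c ∈ [0, 1]` the slope of the Huber function. At a
regular point the coefficient is positive (`injective_fderiv_smoothEHat`).

*Line search.* An admissible direction solves the Newton equation for `Ê` up to an error of at most
`δ ‖Ê‖` with `δ < 1` (`norm_newton_residual_le`). Strict differentiability then gives a step size
that is accepted at all points near a given one, along all admissible directions of bounded length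
(`exists_armijo_step`, `exists_uniform_trial`). Applied at a single iterate this is the termination
of the line search. Positivity of `ε` is kept because each new `ε` is a convex combination of the
old one and of a positive number (`SNStep.min_le_eps`).

*Convergence.* If `Ê ≠ 0` at an accumulation point, then the residual norms along the sequence are
bounded away from zero, hence so are the `ζ_k` and the smoothing parameters
(`eps_pos_of_mapClusterPt`), and the accumulation point is regular. Invertibility of the Jacobian
bounds the admissible directions nearby (`exists_bound_of_injective_fderiv`), so step sizes there
are bounded below, and the merit function would fall below its limit
(`smoothEHat_eq_zero_of_mapClusterPt`).
-/

/-! ### The Huber smoothing function -/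

theorem hasDerivAt_posPart_sq (x : ℝ) :
    HasDerivAt (fun x : ℝ => max x 0 ^ 2) (2 * max x 0) x := by
  rcases lt_trichotomy x 0 with hx | rfl | hx
  · rw [max_eq_right hx.le, mul_zero]
    refine (hasDerivAt_const x (0 : ℝ)).congr_of_eventuallyEq ?_
    filter_upwards [eventually_lt_nhds hx] with y hy
    rw [max_eq_right hy.le]; norm_num
  · rw [hasDerivAt_iff_isLittleO]
    refine Asymptotics.IsBigO.trans_isLittleO (g := fun y : ℝ => y ^ 2) ?_ ?_
    · refine Asymptotics.IsBigO.of_bound 1 (Eventually.of_forall fun y => ?_)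
      rcases le_total y 0 with hy | hy <;> simp [hy]; positivity
    · simpa using Asymptotics.isLittleO_pow_id (𝕜 := ℝ) one_lt_two
  · rw [max_eq_left hx.le]
    have h : HasDerivAt (fun x : ℝ => x ^ 2) (2 * x) x := by simpa using hasDerivAt_pow 2 x
    refine h.congr_of_eventuallyEq ?_
    filter_upwards [eventually_gt_nhds hx] with y hy
    rw [max_eq_left hy.le]

theorem contDiff_posPart_sq : ContDiff ℝ 1 (fun x : ℝ => max x 0 ^ 2) := by
  rw [contDiff_one_iff_deriv]
  refine ⟨fun x => (hasDerivAt_posPart_sq x).differentiableAt, ?_⟩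
  rw [show deriv (fun x : ℝ => max x 0 ^ 2) = fun x => 2 * max x 0 from
    funext fun x => (hasDerivAt_posPart_sq x).deriv]
  fun_prop

/-- A closed form of the three branches that shows their `C¹` fit, since `x ↦ x₊²` is `C¹`. -/
theorem huber_eq_posPart_sq {ε : ℝ} (hε : ε ≠ 0) (t : ℝ) :
    huber ε t = (max t 0 ^ 2 - max (t - |ε|) 0 ^ 2) / (2 * |ε|) := by
  have h := abs_pos.2 hε
  rw [huber, if_neg hε]
  split_ifs with h1 h2
  · rw [max_eq_left (by linarith), max_eq_left (by linarith)]
    field_simp; ring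
  · rw [max_eq_left h2, max_eq_right (by linarith)]; simp
  · rw [max_eq_right (by linarith), max_eq_right (by linarith)]; simp

theorem contDiffAt_huber {ε t : ℝ} (hε : ε ≠ 0) :
    ContDiffAt ℝ 1 (fun x : ℝ × ℝ => huber x.1 x.2) (ε, t) := by
  have habs : ContDiffAt ℝ 1 (fun x : ℝ × ℝ => |x.1|) (ε, t) :=
    (contDiffAt_abs (n := 1) hε).comp (ε, t) contDiffAt_fst
  have h : ContDiffAt ℝ 1 (fun x : ℝ × ℝ =>
      (max x.2 0 ^ 2 - max (x.2 - |x.1|) 0 ^ 2) / (2 * |x.1|)) (ε, t) := by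
    refine ContDiffAt.div (ContDiffAt.sub ?_ ?_) (contDiffAt_const.mul habs) ?_
    · exact contDiff_posPart_sq.contDiffAt.comp (ε, t) contDiffAt_snd
    · exact contDiff_posPart_sq.contDiffAt.comp (ε, t) (contDiffAt_snd.sub habs)
    · simpa using hε
  refine h.congr_of_eventuallyEq ?_
  filter_upwards [continuousAt_fst.eventually_ne (x := (ε, t)) hε] with x hx
  exact huber_eq_posPart_sq hx x.2

/-- The slope of the smoothing function in its second argument lies in `[0, 1]`. -/
theorem exists_hasDerivAt_huber {ε : ℝ} (hε : ε ≠ 0) (t : ℝ) :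
    ∃ c ∈ Set.Icc (0 : ℝ) 1, HasDerivAt (huber ε) c t := by
  have h := abs_pos.2 hε
  refine ⟨(max t 0 - max (t - |ε|) 0) / |ε|, ⟨?_, ?_⟩, ?_⟩
  · have : max (t - |ε|) 0 ≤ max t 0 := max_le_max (by linarith) le_rfl
    exact div_nonneg (by linarith) h.le
  · rw [div_le_one h]
    have : max t 0 ≤ max (t - |ε|) 0 + |ε| :=
      max_le (by linarith [le_max_left (t - |ε|) 0]) (by linarith [le_max_right (t - |ε|) 0])
    linarith
  · have h1 := (hasDerivAt_posPart_sq t).sub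
      ((hasDerivAt_posPart_sq (t - |ε|)).comp t ((hasDerivAt_id t).sub_const |ε|))
    have h2 := h1.div_const (2 * |ε|)
    rw [show huber ε = fun t => (max t 0 ^ 2 - max (t - |ε|) 0 ^ 2) / (2 * |ε|) from
      funext fun t => huber_eq_posPart_sq hε t]
    refine h2.congr_deriv ?_
    field_simp

theorem abs_huber_sub_max_le (ε t : ℝ) : |huber ε t - max 0 t| ≤ |ε| := by
  unfold huber
  split_ifs with h0 h1 h2
  · simp [h0]
  · have := abs_nonneg ε
    rw [max_eq_right (by linarith), abs_le]; constructor <;> linarith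
  · have h := abs_pos.2 h0
    have h3 : 0 ≤ t ^ 2 / (2 * |ε|) := by positivity
    have h4 : t ^ 2 / (2 * |ε|) ≤ t := by rw [div_le_iff₀ (by positivity)]; nlinarith
    rw [max_eq_right h2, abs_le]; constructor <;> linarith
  · rw [max_eq_left (by linarith)]; simp

theorem continuous_huber : Continuous fun x : ℝ × ℝ => huber x.1 x.2 := by
  rw [continuous_iff_continuousAt]
  rintro ⟨ε, t⟩
  by_cases hε : ε = 0
  · subst hε
    have h1 : Tendsto (fun x : ℝ × ℝ => huber x.1 x.2 - max 0 x.2) (𝓝 (0, t)) (𝓝 0) := by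
      refine squeeze_zero_norm (a := fun x : ℝ × ℝ => |x.1|)
        (fun x => abs_huber_sub_max_le x.1 x.2) ?_
      have : Continuous fun x : ℝ × ℝ => |x.1| := by fun_prop
      simpa using this.tendsto (0, t)
    have h2 : Continuous fun x : ℝ × ℝ => max 0 x.2 := by fun_prop
    have h3 := h1.add (h2.tendsto (0, t))
    simpa [ContinuousAt, huber] using h3
  · exact (contDiffAt_huber hε).continuousAt

/-! ### Inexact Newton steps for `C¹` maps -/

/-- Armijo acceptance, uniformly in the point and in the direction: if the Newton equation
`f x + f' x d = 0` holds up to a relative error `δ < 1`, then `‖f (x + t d)‖` is at most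
`(1 - t (1 - δ)) ‖f x‖` up to an error `o(t)` that is uniform for `x` near `x₀` and bounded `d`. -/
theorem exists_armijo_step {E F : Type*} [NormedAddCommGroup E] [NormedSpace ℝ E]
    [NormedAddCommGroup F] [NormedSpace ℝ F] {f : E → F} {x₀ : E} (hf : ContDiffAt ℝ 1 f x₀)
    (hx₀ : f x₀ ≠ 0) {σ δ : ℝ} (hσ : σ < 1 / 2) (hσ0 : 0 < σ) (hδ0 : 0 ≤ δ) (hδ : δ < 1) (M : ℝ) :
    ∃ t₀ > 0, ∀ᶠ x in 𝓝 x₀, ∀ d, ‖d‖ ≤ M → ‖f x + fderiv ℝ f x d‖ ≤ δ * ‖f x‖ →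
      ∀ t, 0 < t → t ≤ t₀ → ‖f (x + t • d)‖ ^ 2 ≤ (1 - 2 * σ * (1 - δ) * t) * ‖f x‖ ^ 2 := by
  have hN : 0 < ‖f x₀‖ := norm_pos_iff.2 hx₀
  set N := ‖f x₀‖ with hNdef
  -- the linearization error is allowed to consume the fraction `1 / 2 - σ` of the decrease
  set K := max M 1 with hK
  have hK1 : 1 ≤ K := le_max_right _ _
  set c := (1 / 2 - σ) * (1 - δ) * (N / 2) / (2 * K) with hc
  have hcpos : 0 < c := by
    have : 0 < 1 / 2 - σ := by linarith
    have : 0 < 1 - δ := by linarith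
    positivity
  have hs : HasStrictFDerivAt f (fderiv ℝ f x₀) x₀ := hf.hasStrictFDerivAt one_ne_zero
  have h1 : ∀ᶠ p : E × E in 𝓝 (x₀, x₀),
      ‖f p.1 - f p.2 - fderiv ℝ f x₀ (p.1 - p.2)‖ ≤ c * ‖p.1 - p.2‖ :=
    hs.isLittleO.def hcpos
  obtain ⟨u, hu, hu1⟩ : ∃ r > 0, ∀ p : E × E, dist p (x₀, x₀) < r →
      ‖f p.1 - f p.2 - fderiv ℝ f x₀ (p.1 - p.2)‖ ≤ c * ‖p.1 - p.2‖ :=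
    Metric.eventually_nhds_iff.1 h1 |>.imp fun r hr => ⟨hr.1, fun p hp => hr.2 hp⟩
  have h2 : ∀ᶠ x in 𝓝 x₀, ‖fderiv ℝ f x - fderiv ℝ f x₀‖ < c := by
    have h := (hf.continuousAt_fderiv one_ne_zero)
    simpa [dist_eq_norm] using Metric.continuousAt_iff'.1 h c hcpos
  have h3 : ∀ᶠ x in 𝓝 x₀, N / 2 < ‖f x‖ :=
    hf.continuousAt.norm.eventually_const_lt (by linarith)
  refine ⟨min 1 (u / (2 * K)), by positivity, ?_⟩
  filter_upwards [h2, h3, Metric.ball_mem_nhds x₀ (half_pos hu)] with x hx2 hx3 hx4 d hd hres t ht htt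
  have ht1 : t ≤ 1 := htt.trans (min_le_left _ _)
  have htu : t ≤ u / (2 * K) := htt.trans (min_le_right _ _)
  have hdK : ‖d‖ ≤ K := hd.trans (le_max_left _ _)
  have htd : ‖t • d‖ ≤ t * K := by
    rw [norm_smul, Real.norm_of_nonneg ht.le]; gcongr
  have htd' : ‖t • d‖ ≤ u / 2 := htd.trans (by
    rw [le_div_iff₀ (by positivity)] at htu; linarith)
  rw [Metric.mem_ball, dist_eq_norm] at hx4
  have e1 := hu1 (x + t • d, x) (by
    rw [Prod.dist_eq, dist_eq_norm, dist_eq_norm]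
    refine max_lt ?_ (by dsimp; linarith)
    calc ‖x + t • d - x₀‖ = ‖(x - x₀) + t • d‖ := by congr 1; abel
      _ ≤ ‖x - x₀‖ + ‖t • d‖ := norm_add_le _ _
      _ < u := by linarith)
  simp only [add_sub_cancel_left] at e1
  have e2 : ‖(fderiv ℝ f x - fderiv ℝ f x₀) (t • d)‖ ≤ c * (t * K) :=
    (ContinuousLinearMap.le_opNorm _ _).trans (by gcongr)
  have e3 : f (x + t • d) = (1 - t) • f x + t • (f x + fderiv ℝ f x d) +
      ((f (x + t • d) - f x - fderiv ℝ f x₀ (t • d)) -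
        (fderiv ℝ f x - fderiv ℝ f x₀) (t • d)) := by
    simp only [_root_.sub_apply, map_smul]
    module
  have e4 : ‖f (x + t • d)‖ ≤ (1 - t) * ‖f x‖ + t * (δ * ‖f x‖) + (c * (t * K) + c * (t * K)) := by
    conv_lhs => rw [e3]
    refine (norm_add_le _ _).trans (add_le_add ((norm_add_le _ _).trans (add_le_add ?_ ?_))
      ((norm_sub_le _ _).trans (add_le_add ?_ ?_)))
    · rw [norm_smul, Real.norm_of_nonneg (by linarith)]
    · rw [norm_smul, Real.norm_of_nonneg ht.le]; gcongr
    · exact e1.trans (by gcongr)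
    · exact e2
  have e5 : c * (t * K) + c * (t * K) = t * ((1 / 2 - σ) * (1 - δ) * (N / 2)) := by
    rw [hc]; field_simp; ring
  set a := (1 - δ) * t with ha
  have ha0 : 0 < a := mul_pos (by linarith) ht
  have hat : a ≤ t := by rw [ha]; nlinarith
  have e6 : ‖f (x + t • d)‖ ≤ (1 - a * (1 / 2 + σ)) * ‖f x‖ := by
    rw [e5] at e4
    have : t * ((1 / 2 - σ) * (1 - δ) * (N / 2)) ≤ a * (1 / 2 - σ) * ‖f x‖ := by
      rw [show t * ((1 / 2 - σ) * (1 - δ) * (N / 2)) = a * (1 / 2 - σ) * (N / 2) by rw [ha]; ring]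
      have : 0 ≤ a * (1 / 2 - σ) := mul_nonneg ha0.le (by linarith)
      gcongr
    rw [ha] at this ⊢
    linarith
  have e7 : (1 - a * (1 / 2 + σ)) ^ 2 ≤ 1 - 2 * σ * a := by
    have h : a * (1 / 2 + σ) ^ 2 ≤ 1 := by
      have : (1 / 2 + σ) ^ 2 ≤ 1 := by nlinarith
      nlinarith
    nlinarith
  calc ‖f (x + t • d)‖ ^ 2 ≤ ((1 - a * (1 / 2 + σ)) * ‖f x‖) ^ 2 := by gcongr
    _ = (1 - a * (1 / 2 + σ)) ^ 2 * ‖f x‖ ^ 2 := by ring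
    _ ≤ (1 - 2 * σ * a) * ‖f x‖ ^ 2 := by gcongr
    _ = _ := by rw [ha]; ring

/-- Near a point where a `C¹` map has an injective derivative, solutions of the linearized
equations with bounded right-hand sides are bounded. -/
theorem exists_bound_of_injective_fderiv {E F : Type*} [NormedAddCommGroup E] [NormedSpace ℝ E]
    [FiniteDimensional ℝ E] [NormedAddCommGroup F] [NormedSpace ℝ F] {f : E → F} {x₀ : E}
    (hf : ContDiffAt ℝ 1 f x₀) (hinj : Function.Injective (fderiv ℝ f x₀)) :
    ∃ K > 0, ∀ᶠ x in 𝓝 x₀, ∀ d, ‖d‖ ≤ K * ‖fderiv ℝ f x d‖ := by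
  obtain ⟨K, hK, hanti⟩ := (fderiv ℝ f x₀).toLinearMap.exists_antilipschitzWith
    (LinearMap.ker_eq_bot.2 hinj)
  have hK' : (0 : ℝ) < K := hK
  refine ⟨2 * K, by positivity, ?_⟩
  have h := Metric.continuousAt_iff'.1 (hf.continuousAt_fderiv one_ne_zero) (1 / (2 * K))
    (by positivity)
  filter_upwards [h] with x hx d
  rw [dist_eq_norm] at hx
  have h1 : ‖d‖ ≤ K * ‖fderiv ℝ f x₀ d‖ := by simpa using hanti.le_mul_dist d 0
  have h2 : ‖(fderiv ℝ f x - fderiv ℝ f x₀) d‖ ≤ 1 / (2 * K) * ‖d‖ :=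
    (ContinuousLinearMap.le_opNorm _ _).trans (by gcongr)
  have h3 : ‖fderiv ℝ f x₀ d‖ ≤ ‖fderiv ℝ f x d‖ + 1 / (2 * K) * ‖d‖ := by
    have h4 := norm_sub_le (fderiv ℝ f x d) ((fderiv ℝ f x - fderiv ℝ f x₀) d)
    rw [_root_.sub_apply, sub_sub_cancel] at h4
    rw [_root_.sub_apply] at h2
    linarith
  have h5 : K * (1 / (2 * K) * ‖d‖) = ‖d‖ / 2 := by field_simp
  have h6 : K * ‖fderiv ℝ f x₀ d‖ ≤ K * (‖fderiv ℝ f x d‖ + 1 / (2 * K) * ‖d‖) := by gcongr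
  rw [mul_add, h5] at h6
  linarith

/-! ### Smoothness of the smoothing system -/

theorem contDiff_mulVec_apply {ι κ : Type*} [Fintype ι] [Fintype κ] (M : Matrix ι κ ℝ)
    (i : ι) : ContDiff ℝ 1 fun w : κ → ℝ => (M *ᵥ w) i :=
  (LinearMap.proj i ∘ₗ Matrix.mulVecLin M).toContinuousLinearMap.contDiff

namespace SNPoint

variable {T n : ℕ}

theorem contDiff_eps : ContDiff ℝ 1 (eps : SNPoint T n → ℝ) := by unfold eps; fun_prop

theorem contDiff_C : ContDiff ℝ 1 (C : SNPoint T n → ℝ) := by unfold C; fun_prop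

theorem contDiff_mu : ContDiff ℝ 1 (mu : SNPoint T n → _) := by unfold mu; fun_prop

theorem contDiff_w : ContDiff ℝ 1 (w : SNPoint T n → _) := by unfold w; fun_prop

end SNPoint

namespace CVData

variable {T n m₁ m₂ : ℕ} (D : CVData T n m₁ m₂) (S : SNParams)

theorem contDiff_g : ContDiff ℝ 1 D.g := by
  have hh : ContDiff ℝ 1 fun w => D.hX w - D.y := by
    refine ContDiff.sub (contDiff_pi.2 fun i => ?_) contDiff_const
    have h := contDiff_mulVec_apply D.Xᵀ i
    unfold hX
    exact (contDiff_const.sub h.neg.exp).div (contDiff_const.add h.neg.exp) fun w => by positivity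
  exact ((Matrix.mulVecLin D.X).toContinuousLinearMap.contDiff.comp hh).const_smul (1 / 2 : ℝ)

theorem contDiff_gradF : ContDiff ℝ 1 D.gradF := by
  unfold gradF
  refine ((Matrix.mulVecLin D.Aᵀ).toContinuousLinearMap.contDiff.comp (contDiff_pi.2 fun i => ?_)).neg
  have h := contDiff_mulVec_apply D.A i
  unfold s
  exact (contDiff_const.add h.exp).inv fun w => by positivity

theorem contDiff_u : ContDiff ℝ 1 D.u := by
  refine contDiff_pi.2 fun i => ?_
  have h := contDiff_mulVec_apply D.Xᵀ i
  unfold u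
  exact ((contDiff_const.add h.neg.exp).add h.exp).inv fun w => by positivity

theorem gradG_mulVec (w x : Fin T × Fin n → ℝ) :
    D.gradG w *ᵥ x = D.X *ᵥ (D.u w * (D.Xᵀ *ᵥ x)) := by
  rw [gradG, ← Matrix.mulVec_mulVec, ← Matrix.mulVec_mulVec]
  congr 1
  ext i
  simp [Matrix.mulVec_diagonal]

theorem P_mulVec (c : ℝ) (w x : Fin T × Fin n → ℝ) :
    D.P c w *ᵥ x = x + c • (D.gradG w *ᵥ x) := by
  rw [P, Matrix.add_mulVec, Matrix.one_mulVec, Matrix.smul_mulVec]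

theorem contDiff_gradG_mulVec {f k : SNPoint T n → Fin T × Fin n → ℝ} (hf : ContDiff ℝ 1 f)
    (hk : ContDiff ℝ 1 k) : ContDiff ℝ 1 fun b => D.gradG (f b) *ᵥ k b := by
  simp only [gradG_mulVec]
  refine (Matrix.mulVecLin D.X).toContinuousLinearMap.contDiff.comp (ContDiff.mul ?_ ?_)
  · exact D.contDiff_u.comp hf
  · exact (Matrix.mulVecLin D.Xᵀ).toContinuousLinearMap.contDiff.comp hk

/-- The second argument of the smoothing function in the first component of `𝓔`. -/
theorem contDiff_gap :
    ContDiff ℝ 1 fun b : SNPoint T n => b.C - b.mu ⬝ᵥ D.g b.w := by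
  refine SNPoint.contDiff_C.sub ?_
  unfold dotProduct
  refine ContDiff.sum fun i _ => ContDiff.mul ?_ ?_
  · exact contDiff_pi.1 SNPoint.contDiff_mu i
  · exact contDiff_pi.1 (D.contDiff_g.comp SNPoint.contDiff_w) i

theorem contDiff_lagrange : ContDiff ℝ 1 fun b : SNPoint T n =>
    (1 / ((T : ℝ) * m₁)) • D.gradF b.w + D.P b.C b.w *ᵥ b.mu := by
  simp only [P_mulVec]
  exact ((D.contDiff_gradF.comp SNPoint.contDiff_w).const_smul _).add
    (SNPoint.contDiff_mu.add (SNPoint.contDiff_C.smul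
      (D.contDiff_gradG_mulVec SNPoint.contDiff_w SNPoint.contDiff_mu)))

theorem contDiff_feasibility : ContDiff ℝ 1 fun b : SNPoint T n => b.w + b.C • D.g b.w :=
  SNPoint.contDiff_w.add (SNPoint.contDiff_C.smul (D.contDiff_g.comp SNPoint.contDiff_w))

theorem contDiffAt_smoothEHat {b : SNPoint T n} (hb : b.eps ≠ 0) :
    ContDiffAt ℝ 1 (D.smoothEHat S) b := by
  rw [contDiffAt_euclidean]
  rintro (_ | _ | a | a)
  · exact SNPoint.contDiff_eps.contDiffAt
  · refine ContDiffAt.sub (ContDiffAt.mul (contDiffAt_const.add (contDiffAt_const.mul ?_))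
      SNPoint.contDiff_C.contDiffAt) ?_
    · exact (contDiffAt_abs (n := 1) hb).comp b SNPoint.contDiff_eps.contDiffAt
    · exact (contDiffAt_huber hb).comp b
        (SNPoint.contDiff_eps.contDiffAt.prodMk D.contDiff_gap.contDiffAt)
  · exact (contDiff_pi.1 D.contDiff_lagrange a).contDiffAt
  · exact (contDiff_pi.1 D.contDiff_feasibility a).contDiffAt

theorem continuous_smoothEHat : Continuous (D.smoothEHat S) := by
  refine (PiLp.continuous_toLp 2 _).comp (continuous_pi ?_)
  have he := (SNPoint.contDiff_eps (T := T) (n := n)).continuous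
  rintro (_ | _ | a | a)
  · exact he
  · exact ((continuous_const.add (continuous_const.mul he.abs)).mul
      SNPoint.contDiff_C.continuous).sub
      (continuous_huber.comp (he.prodMk D.contDiff_gap.continuous))
  · exact (contDiff_pi.1 D.contDiff_lagrange a).continuous
  · exact (contDiff_pi.1 D.contDiff_feasibility a).continuous

theorem eps_smoothEHat (b : SNPoint T n) : (D.smoothEHat S b).eps = b.eps := rfl

/-- The projection onto the coordinates after the first. -/
noncomputable def tailCLM (T n : ℕ) : SNPoint T n →L[ℝ] SNRes T n :=
  LinearMap.toContinuousLinearMap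
    { toFun := fun x => WithLp.toLp 2 fun i => x (Sum.inr i)
      map_add' := fun _ _ => rfl
      map_smul' := fun _ _ => rfl }

theorem tailCLM_apply (x : SNPoint T n) (i) : tailCLM T n x i = x (Sum.inr i) := rfl

theorem norm_sq_eq (x : SNPoint T n) : ‖x‖ ^ 2 = x.eps ^ 2 + ‖tailCLM T n x‖ ^ 2 := by
  rw [EuclideanSpace.norm_sq_eq, EuclideanSpace.norm_sq_eq, Fintype.sum_sum_type]
  simp [SNPoint.eps, tailCLM_apply]

theorem fderiv_smoothE {b : SNPoint T n} (hb : b.eps ≠ 0) (d : SNPoint T n) :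
    fderiv ℝ (D.smoothE S) b d = tailCLM T n (fderiv ℝ (D.smoothEHat S) b d) := by
  have h := ((tailCLM T n).hasFDerivAt.comp b
    ((D.contDiffAt_smoothEHat S hb).differentiableAt one_ne_zero).hasFDerivAt)
  have h' : HasFDerivAt (D.smoothE S) _ b := h
  rw [h'.fderiv]; rfl

/-- The projection onto the first coordinate. -/
noncomputable def epsCLM (T n : ℕ) : SNPoint T n →L[ℝ] ℝ := EuclideanSpace.proj (Sum.inl ())

theorem eps_fderiv_smoothEHat {b : SNPoint T n} (hb : b.eps ≠ 0) (d : SNPoint T n) :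
    (fderiv ℝ (D.smoothEHat S) b d).eps = d.eps := by
  have h := ((epsCLM T n).hasFDerivAt.comp b
    ((D.contDiffAt_smoothEHat S hb).differentiableAt one_ne_zero).hasFDerivAt)
  have h' : HasFDerivAt (epsCLM T n) _ b := h
  exact congrArg (· d) (h'.unique (epsCLM T n).hasFDerivAt)

/-! ### The Jacobian of the smoothing system, computed along lines -/

theorem hasDerivAt_mulVec_line {ι κ : Type*} [Fintype ι] [Fintype κ] (M : Matrix ι κ ℝ)
    (w d : κ → ℝ) (i : ι) :
    HasDerivAt (fun t : ℝ => (M *ᵥ (w + t • d)) i) ((M *ᵥ d) i) 0 := by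
  simp only [Matrix.mulVec_add, Matrix.mulVec_smul, Pi.add_apply, Pi.smul_apply, smul_eq_mul]
  simpa using ((hasDerivAt_id (0 : ℝ)).mul_const ((M *ᵥ d) i)).const_add ((M *ᵥ w) i)

theorem hasDerivAt_line {κ : Type*} [Fintype κ] (w d : κ → ℝ) :
    HasDerivAt (fun t : ℝ => w + t • d) d 0 := by
  simpa using ((hasDerivAt_id (0 : ℝ)).smul_const d).const_add w

theorem hasDerivAt_g_line (w d : Fin T × Fin n → ℝ) :
    HasDerivAt (fun t : ℝ => D.g (w + t • d)) (D.gradG w *ᵥ d) 0 := by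
  have h := D.hasFDerivAt_g (w + (0 : ℝ) • d)
  have h2 := h.comp_hasDerivAt (0 : ℝ) (hasDerivAt_line w d)
  exact HasDerivAt.congr_deriv h2 (by simp)

theorem hasDerivAt_gradF_line (w d : Fin T × Fin n → ℝ) :
    HasDerivAt (fun t : ℝ => D.gradF (w + t • d))
      ((D.Aᵀ * Matrix.diagonal (D.p w) * D.A) *ᵥ d) 0 := by
  have h1 : HasDerivAt (fun t : ℝ => D.s (w + t • d)) (-(D.p w * (D.A *ᵥ d))) 0 := by
    refine hasDerivAt_pi.2 fun i => ?_
    have h := (((hasDerivAt_mulVec_line D.A w d i).exp).const_add 1).inv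
      (by positivity)
    refine h.congr_deriv ?_
    simp [p]; ring
  have h2 := ((Matrix.mulVecLin D.Aᵀ).toContinuousLinearMap.hasFDerivAt.comp_hasDerivAt
    (0 : ℝ) h1).neg
  refine h2.congr_deriv ?_
  rw [← Matrix.mulVec_mulVec, ← Matrix.mulVec_mulVec]
  simp only [LinearMap.coe_toContinuousLinearMap', Matrix.mulVecLin_apply, Matrix.mulVec_neg,
    neg_neg]
  congr 1
  ext i
  simp [Matrix.mulVec_diagonal]

theorem hasDerivAt_u_line (w d : Fin T × Fin n → ℝ) :
    HasDerivAt (fun t : ℝ => D.u (w + t • d)) (D.q w * (D.Xᵀ *ᵥ d)) 0 := by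
  refine hasDerivAt_pi.2 fun i => ?_
  have h0 := hasDerivAt_mulVec_line D.Xᵀ w d i
  have h := ((h0.neg.exp.const_add 2).add h0.exp).inv (by simp; positivity)
  refine h.congr_deriv ?_
  have hp : 0 < Real.exp ((D.Xᵀ *ᵥ w) i) := Real.exp_pos _
  simp only [q, Pi.mul_apply, zero_smul, add_zero, Pi.add_apply, Pi.neg_apply, Real.exp_neg]
  have h3 : 0 < 2 + (Real.exp ((D.Xᵀ *ᵥ w) i))⁻¹ + Real.exp ((D.Xᵀ *ᵥ w) i) := by positivity
  generalize Real.exp ((D.Xᵀ *ᵥ w) i) = e at *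
  have : 2 + e⁻¹ + e = (e + 1) ^ 2 / e := by field_simp; ring
  rw [this]
  field_simp
  ring

theorem hasDerivAt_gradG_mulVec_line (w d μ ν : Fin T × Fin n → ℝ) :
    HasDerivAt (fun t : ℝ => D.gradG (w + t • d) *ᵥ (μ + t • ν))
      ((D.X * Matrix.diagonal (D.Xᵀ *ᵥ μ) * Matrix.diagonal (D.q w) * D.Xᵀ) *ᵥ d
        + D.gradG w *ᵥ ν) 0 := by
  simp only [gradG_mulVec]
  have h1 : HasDerivAt (fun t : ℝ => D.Xᵀ *ᵥ (μ + t • ν)) (D.Xᵀ *ᵥ ν) 0 :=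
    hasDerivAt_pi.2 fun i => hasDerivAt_mulVec_line D.Xᵀ μ ν i
  have h2 : HasDerivAt (fun t : ℝ => D.u (w + t • d) * (D.Xᵀ *ᵥ (μ + t • ν)))
      (D.q w * (D.Xᵀ *ᵥ d) * (D.Xᵀ *ᵥ μ) + D.u w * (D.Xᵀ *ᵥ ν)) 0 := by
    exact HasDerivAt.congr_deriv ((D.hasDerivAt_u_line w d).mul h1) (by simp)
  have h3 := (Matrix.mulVecLin D.X).toContinuousLinearMap.hasFDerivAt.comp_hasDerivAt (0 : ℝ) h2
  refine h3.congr_deriv ?_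
  simp only [← Matrix.mulVec_mulVec, LinearMap.coe_toContinuousLinearMap', Matrix.mulVecLin_apply,
    ← Matrix.mulVec_add]
  congr 1
  ext i
  simp only [Matrix.mulVec_diagonal, Pi.add_apply, Pi.mul_apply]
  ring

theorem gradG_isSymm (w : Fin T × Fin n → ℝ) : (D.gradG w)ᵀ = D.gradG w := by
  simp [gradG, Matrix.transpose_mul, Matrix.mul_assoc]

theorem P_isSymm (c : ℝ) (w : Fin T × Fin n → ℝ) : (D.P c w)ᵀ = D.P c w := by
  simp [P, gradG_isSymm]

theorem hasDerivAt_smoothEHat_line {b d : SNPoint T n} (hb : b.eps ≠ 0) (i) :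
    HasDerivAt (fun t : ℝ => D.smoothEHat S (b + t • d) i)
      (fderiv ℝ (D.smoothEHat S) b d i) 0 := by
  have h := ((D.contDiffAt_smoothEHat S hb).differentiableAt one_ne_zero).hasFDerivAt
  have h1 : HasDerivAt (fun t : ℝ => b + t • d) d 0 := by
    simpa using ((hasDerivAt_id (0 : ℝ)).smul_const d).const_add b
  have h2 := HasFDerivAt.comp_hasDerivAt (0 : ℝ) (by simpa using h) h1
  exact (EuclideanSpace.proj i : SNPoint T n →L[ℝ] ℝ).hasFDerivAt.comp_hasDerivAt (0 : ℝ) h2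

theorem eps_line (b d : SNPoint T n) (t : ℝ) : (b + t • d).eps = b.eps + t * d.eps := rfl

theorem hasDerivAt_C_line (b d : SNPoint T n) :
    HasDerivAt (fun t : ℝ => b.C + t * d.C) d.C 0 := by
  simpa using ((hasDerivAt_id (0 : ℝ)).mul_const d.C).const_add b.C

theorem w_fderiv_smoothEHat {b : SNPoint T n} (hb : b.eps ≠ 0) (d : SNPoint T n) :
    (fderiv ℝ (D.smoothEHat S) b d).w = D.P b.C b.w *ᵥ d.w + d.C • D.g b.w := by
  funext a
  have h1 := D.hasDerivAt_smoothEHat_line S (d := d) hb (Sum.inr (Sum.inr (Sum.inr a)))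
  have h2 := (hasDerivAt_line b.w d.w).add
    ((hasDerivAt_C_line b d).smul (D.hasDerivAt_g_line b.w d.w))
  refine (h1.unique (hasDerivAt_pi.1 h2 a)).trans ?_
  simp [P_mulVec]
  ring

theorem mu_fderiv_smoothEHat {b : SNPoint T n} (hb : b.eps ≠ 0) (d : SNPoint T n) :
    (fderiv ℝ (D.smoothEHat S) b d).mu =
      D.alpha b.mu b.C b.w *ᵥ d.w + D.P b.C b.w *ᵥ d.mu + d.C • (D.gradG b.w *ᵥ b.mu) := by
  funext a
  have h1 := D.hasDerivAt_smoothEHat_line S (d := d) hb (Sum.inr (Sum.inr (Sum.inl a)))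
  have h2 := ((D.hasDerivAt_gradF_line b.w d.w).const_smul (1 / ((T : ℝ) * m₁))).add
    ((hasDerivAt_line b.mu d.mu).add
      ((hasDerivAt_C_line b d).smul (D.hasDerivAt_gradG_mulVec_line b.w d.w b.mu d.mu)))
  have h3 : (fun t : ℝ => D.smoothEHat S (b + t • d) (Sum.inr (Sum.inr (Sum.inl a)))) =
      fun t : ℝ => ((1 / ((T : ℝ) * m₁)) • D.gradF (b.w + t • d.w) + ((b.mu + t • d.mu) +
        (b.C + t * d.C) • (D.gradG (b.w + t • d.w) *ᵥ (b.mu + t • d.mu)))) a := by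
    funext t
    rw [← P_mulVec]
    rfl
  rw [h3] at h1
  refine (h1.unique (hasDerivAt_pi.1 h2 a)).trans ?_
  simp only [alpha, P_mulVec, Matrix.add_mulVec, Matrix.smul_mulVec, zero_smul, add_zero,
    zero_mul, Pi.add_apply, Pi.smul_apply, smul_eq_mul]
  ring

/-- The row of the Jacobian that carries the smoothing function, on directions that leave the
smoothing parameter unchanged. -/
theorem exists_C_fderiv_smoothEHat {b : SNPoint T n} (hb : b.eps ≠ 0) :
    ∃ c ∈ Set.Icc (0 : ℝ) 1, ∀ d : SNPoint T n, d.eps = 0 →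
      (fderiv ℝ (D.smoothEHat S) b d).C = (1 + S.κ * |b.eps|) * d.C -
        c * (d.C - (d.mu ⬝ᵥ D.g b.w + b.mu ⬝ᵥ (D.gradG b.w *ᵥ d.w))) := by
  obtain ⟨c, hc, hd⟩ := exists_hasDerivAt_huber hb (b.C - b.mu ⬝ᵥ D.g b.w)
  refine ⟨c, hc, fun d hd0 => ?_⟩
  have h1 := D.hasDerivAt_smoothEHat_line S (d := d) hb (Sum.inr (Sum.inl ()))
  have h2 : HasDerivAt (fun t : ℝ => (b.mu + t • d.mu) ⬝ᵥ D.g (b.w + t • d.w))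
      (d.mu ⬝ᵥ D.g b.w + b.mu ⬝ᵥ (D.gradG b.w *ᵥ d.w)) 0 := by
    simp only [dotProduct, ← Finset.sum_add_distrib]
    refine HasDerivAt.fun_sum fun i _ => ?_
    exact HasDerivAt.congr_deriv ((hasDerivAt_pi.1 (hasDerivAt_line b.mu d.mu) i).mul
      (hasDerivAt_pi.1 (D.hasDerivAt_g_line b.w d.w) i)) (by simp)
  have h3 := (hasDerivAt_C_line b d).sub h2
  have h4 := HasDerivAt.comp (0 : ℝ) (h₂ := huber b.eps) (by simpa using hd) h3
  have h5 := ((hasDerivAt_C_line b d).const_mul (1 + S.κ * |b.eps|)).sub h4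
  have h6 : (fun t : ℝ => D.smoothEHat S (b + t • d) (Sum.inr (Sum.inl ()))) =
      fun t : ℝ => (1 + S.κ * |b.eps|) * (b.C + t * d.C) -
        huber b.eps ((b.C + t * d.C) - (b.mu + t • d.mu) ⬝ᵥ D.g (b.w + t • d.w)) := by
    funext t
    have : (b + t • d).eps = b.eps := by rw [eps_line, hd0, mul_zero, add_zero]
    rw [← this]
    rfl
  rw [h6] at h1
  exact h1.unique h5

/-! ### Nonsingularity at regular points -/

/-- Eliminating `Δw` and `Δμ` from the homogeneous Newton system leaves
`((1 - c) + κ ε + c z) ΔC = 0` with `c ∈ [0, 1]`, whose coefficient is positive. -/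
theorem injective_fderiv_smoothEHat {b : SNPoint T n} (hb : 0 < b.eps) (hr : D.SNRegular S b) :
    Function.Injective (fderiv ℝ (D.smoothEHat S) b) := by
  obtain ⟨hP, hz⟩ := hr
  rw [injective_iff_map_eq_zero]
  intro d hd
  obtain ⟨c, ⟨hc0, hc1⟩, hC⟩ := D.exists_C_fderiv_smoothEHat S hb.ne'
  have he : d.eps = 0 := by rw [← D.eps_fderiv_smoothEHat S hb.ne' d, hd]; rfl
  have hw := D.w_fderiv_smoothEHat S hb.ne' d
  have hm := D.mu_fderiv_smoothEHat S hb.ne' d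
  specialize hC d he
  rw [hd] at hw hm hC
  change 0 = _ at hw hm hC
  set G := D.gradG b.w with hG
  set g := D.g b.w with hg
  set a := D.alpha b.mu b.C b.w with ha
  set P := D.P b.C b.w with hPdef
  have hinv : ∀ x, P⁻¹ *ᵥ (P *ᵥ x) = x := fun x => by
    rw [Matrix.mulVec_mulVec, Matrix.nonsing_inv_mul _ hP, Matrix.one_mulVec]
  have hsymm : ∀ x y, x ⬝ᵥ (P⁻¹ *ᵥ y) = y ⬝ᵥ (P⁻¹ *ᵥ x) := fun x y => by
    rw [Matrix.dotProduct_mulVec, ← Matrix.mulVec_transpose, Matrix.transpose_nonsing_inv, hPdef,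
      P_isSymm, dotProduct_comm]
  have hGsymm : ∀ x y, x ⬝ᵥ (G *ᵥ y) = (G *ᵥ x) ⬝ᵥ y := fun x y => by
    rw [Matrix.dotProduct_mulVec, ← Matrix.mulVec_transpose, hG, gradG_isSymm]
  have hw' : d.w = -(d.C • (P⁻¹ *ᵥ g)) := by
    rw [← hinv d.w, eq_neg_of_add_eq_zero_left hw.symm, Matrix.mulVec_neg, Matrix.mulVec_smul]
  have hm' : d.mu = d.C • (P⁻¹ *ᵥ (a *ᵥ (P⁻¹ *ᵥ g) - G *ᵥ b.mu)) := by
    have : P *ᵥ d.mu = d.C • (a *ᵥ (P⁻¹ *ᵥ g) - G *ᵥ b.mu) := by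
      rw [hw', Matrix.mulVec_neg, Matrix.mulVec_smul] at hm
      rw [smul_sub, eq_sub_iff_add_eq]
      rw [add_assoc, eq_comm, neg_add_eq_zero] at hm
      exact hm.symm
    rw [← hinv d.mu, this, Matrix.mulVec_smul]
  have hsum : d.mu ⬝ᵥ g + b.mu ⬝ᵥ (G *ᵥ d.w) = d.C * D.z b.mu b.C b.w := by
    rw [hGsymm, hm', hw', z, ← hG, ← hg, ← ha, ← hPdef, dotProduct_neg, dotProduct_smul,
      smul_dotProduct, dotProduct_comm _ g, hsymm (G *ᵥ b.mu) g]
    simp only [Matrix.mulVec_sub, Matrix.mulVec_smul, dotProduct_sub, dotProduct_smul, smul_eq_mul]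
    ring
  have hcoef : 0 < (1 - c) + S.κ * b.eps + c * D.z b.mu b.C b.w := by
    have hκ : 0 < S.κ * b.eps := mul_pos S.κ_pos hb
    -- for `c < 1` the bound `c z ≥ -c κ ε` leaves room even if `z < 0`
    rcases hc1.lt_or_eq with h | h
    · nlinarith
    · rw [h]; linarith
  have hdC : d.C = 0 := by
    rw [hsum, abs_of_pos hb] at hC
    have : ((1 - c) + S.κ * b.eps + c * D.z b.mu b.C b.w) * d.C = 0 := by rw [hC]; ring
    exact (mul_eq_zero.1 this).resolve_left hcoef.ne'
  rw [hdC, zero_smul] at hm'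
  rw [hdC, zero_smul, neg_zero] at hw'
  ext i
  rcases i with _ | _ | i | i
  · exact he
  · exact hdC
  · exact congrFun hm' i
  · exact congrFun hw' i

theorem bijective_fderiv_smoothEHat {b : SNPoint T n} (hb : 0 < b.eps) (hr : D.SNRegular S b) :
    Function.Bijective (fderiv ℝ (D.smoothEHat S) b) :=
  ⟨D.injective_fderiv_smoothEHat S hb hr,
    LinearMap.injective_iff_surjective (f := (fderiv ℝ (D.smoothEHat S) b).toLinearMap).1
      (D.injective_fderiv_smoothEHat S hb hr)⟩

end CVData

/-! ### Directions, line search and steps -/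

namespace SNParams

variable (S : SNParams)

theorem delta_nonneg : 0 ≤ S.delta :=
  mul_nonneg (Real.sqrt_nonneg _) (le_max_of_le_right S.etaHat_pos.le)

theorem delta_lt : S.delta < 1 := S.delta_lt_one

end SNParams

namespace CVData

variable {T n m₁ m₂ : ℕ} (D : CVData T n m₁ m₂) (S : SNParams)

theorem smoothEHat_ne_zero {b : SNPoint T n} (hb : b.eps ≠ 0) : D.smoothEHat S b ≠ 0 := by
  intro h
  apply hb
  rw [← D.eps_smoothEHat S, h]
  rfl

theorem zeta_le_norm (b : SNPoint T n) : D.zeta S b ≤ S.r * ‖D.smoothEHat S b‖ := by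
  refine mul_le_mul_of_nonneg_left ?_ S.r_mem.1.le
  have hτ := S.τ_mem.1
  rcases le_total ‖D.smoothEHat S b‖ 1 with h | h
  · refine (min_le_right _ _).trans ?_
    conv_rhs => rw [← Real.rpow_one ‖D.smoothEHat S b‖]
    exact Real.rpow_le_rpow_of_exponent_ge_of_imp (norm_nonneg _) h (by linarith)
      fun _ h' => by linarith
  · exact (min_le_left _ _).trans h

/-- The forcing of the smoothing parameter and the inexactness of the remaining equations
together perturb the Newton equation by at most `δ ‖Ê‖`. -/
theorem norm_newton_residual_le {b d : SNPoint T n} (hb : b.eps ≠ 0)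
    (hd : D.IsSNDirection S b d) :
    ‖D.smoothEHat S b + fderiv ℝ (D.smoothEHat S) b d‖ ≤ S.delta * ‖D.smoothEHat S b‖ := by
  obtain ⟨h1, -, h3⟩ := hd
  set N := ‖D.smoothEHat S b‖ with hN
  have hN0 : 0 ≤ N := norm_nonneg _
  set x := D.smoothEHat S b + fderiv ℝ (D.smoothEHat S) b d with hx
  have hxe : x.eps = D.zeta S b * S.epsHat := by
    have : x.eps = b.eps + (fderiv ℝ (D.smoothEHat S) b d).eps := rfl
    rw [this, D.eps_fderiv_smoothEHat S hb, h1]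
    ring
  have hxt : tailCLM T n x = D.residual S b d := by
    rw [hx, map_add, residual, D.fderiv_smoothE S hb]
    rfl
  have hζ0 : 0 ≤ D.zeta S b := mul_nonneg S.r_mem.1.le (by positivity)
  set m := max (S.r * S.epsHat) S.etaHat with hm
  have hm0 : 0 ≤ m := le_max_of_le_right S.etaHat_pos.le
  have e1 : x.eps ≤ m * N := by
    rw [hxe]
    calc D.zeta S b * S.epsHat ≤ (S.r * N) * S.epsHat := by
          have := D.zeta_le_norm S b
          have := S.epsHat_pos
          gcongr
      _ = (S.r * S.epsHat) * N := by ring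
      _ ≤ m * N := by gcongr; exact le_max_left _ _
  have e1' : 0 ≤ x.eps := hxe ▸ mul_nonneg hζ0 S.epsHat_pos.le
  have e2 : ‖tailCLM T n x‖ ≤ m * N := by
    rw [hxt]
    exact h3.trans (by gcongr; exact le_max_right _ _)
  refine abs_le_of_sq_le_sq' ?_ (mul_nonneg S.delta_nonneg hN0) |>.2
  rw [norm_sq_eq]
  calc x.eps ^ 2 + ‖tailCLM T n x‖ ^ 2 ≤ (m * N) ^ 2 + (m * N) ^ 2 := by gcongr
    _ = (S.delta * N) ^ 2 := by
      rw [SNParams.delta, ← hm, mul_assoc, mul_pow √2, Real.sq_sqrt zero_le_two]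
      ring

/-- The exact solution of the Newton system is admissible. -/
theorem exists_isSNDirection {b : SNPoint T n} (hb : 0 < b.eps) (hr : D.SNRegular S b) :
    ∃ d, D.IsSNDirection S b d := by
  obtain ⟨d, hd⟩ := (D.bijective_fderiv_smoothEHat S hb hr).2
    (EuclideanSpace.single (Sum.inl ()) (D.zeta S b * S.epsHat) - D.smoothEHat S b)
  have h0 : D.residual S b d = 0 := by
    rw [residual, D.fderiv_smoothE S hb.ne', hd, map_sub]
    ext i
    simp [tailCLM_apply, smoothEHat]
  refine ⟨d, ?_, ?_, ?_⟩
  · rw [← D.eps_fderiv_smoothEHat S hb.ne' d, hd, ← D.eps_smoothEHat S b]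
    simp [SNPoint.eps]
    ring
  · rw [h0, norm_zero]
    have := S.rHat_pos
    exact mul_nonneg (le_min zero_le_one (by positivity)) (norm_nonneg _)
  · rw [h0, norm_zero]
    have := S.etaHat_pos
    positivity

/-- Near a point with `ε ≠ 0`, a fixed trial step is accepted along all admissible directions
of bounded length. -/
theorem exists_uniform_trial {b₁ : SNPoint T n} (hb : b₁.eps ≠ 0) (M : ℝ) :
    ∃ l : ℕ, ∀ᶠ b in 𝓝 b₁, ∀ d, ‖d‖ ≤ M → D.IsSNDirection S b d →
      D.merit S (b + S.ρ ^ l • d) ≤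
        (1 - 2 * S.σ * (1 - S.delta) * S.ρ ^ l) * D.merit S b := by
  obtain ⟨t₀, ht₀, h⟩ := exists_armijo_step (D.contDiffAt_smoothEHat S hb)
    (D.smoothEHat_ne_zero S hb) S.σ_mem.2 S.σ_mem.1 S.delta_nonneg S.delta_lt M
  obtain ⟨l, hl⟩ := exists_pow_lt_of_lt_one ht₀ S.ρ_mem.2
  have hne : ∀ᶠ b : SNPoint T n in 𝓝 b₁, b.eps ≠ 0 :=
    SNPoint.contDiff_eps.continuous.continuousAt.eventually_ne hb
  refine ⟨l, ?_⟩
  filter_upwards [h, hne] with b hb' hbe d hdM hd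
  exact hb' d hdM (D.norm_newton_residual_le S hbe hd) _ (pow_pos S.ρ_mem.1 l) hl.le

theorem exists_isSNStepSize {b d : SNPoint T n} (hb : b.eps ≠ 0) (hd : D.IsSNDirection S b d) :
    ∃ l, D.IsSNStepSize S b d l := by
  obtain ⟨l, hl⟩ := D.exists_uniform_trial S hb ‖d‖
  have hne : {l : ℕ | D.merit S (b + S.ρ ^ l • d) ≤
      (1 - 2 * S.σ * (1 - S.delta) * S.ρ ^ l) * D.merit S b}.Nonempty :=
    ⟨l, hl.self_of_nhds d le_rfl hd⟩
  exact ⟨_, Nat.sInf_mem hne, fun k hk => Nat.sInf_le hk⟩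

theorem exists_snStep {b : SNPoint T n} (hb : 0 < b.eps) (hr : D.SNRegular S b) :
    ∃ b', D.SNStep S b b' := by
  obtain ⟨d, hd⟩ := D.exists_isSNDirection S hb hr
  obtain ⟨l, hl⟩ := D.exists_isSNStepSize S hb.ne' hd
  exact ⟨_, D.smoothEHat_ne_zero S hb.ne', d, l, hd, hl, rfl⟩

/-- The new smoothing parameter is a convex combination of the old one and of `ζ ε̂`. -/
theorem SNStep.min_le_eps {b b' : SNPoint T n} (h : D.SNStep S b b') :
    min b.eps (D.zeta S b * S.epsHat) ≤ b'.eps := by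
  obtain ⟨-, d, l, hd, -, rfl⟩ := h
  rw [eps_line, hd.1]
  have h0 : 0 ≤ S.ρ ^ l := pow_nonneg S.ρ_mem.1.le l
  have h1 : S.ρ ^ l ≤ 1 := pow_le_one₀ S.ρ_mem.1.le S.ρ_mem.2.le
  have h2 := min_le_left b.eps (D.zeta S b * S.epsHat)
  have h3 := min_le_right b.eps (D.zeta S b * S.epsHat)
  nlinarith

theorem SNStep.eps_pos {b b' : SNPoint T n} (h : D.SNStep S b b') (hb : 0 < b.eps) :
    0 < b'.eps := by
  refine lt_of_lt_of_le (lt_min hb (mul_pos (mul_pos S.r_mem.1 ?_) S.epsHat_pos))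
    (SNStep.min_le_eps D S h)
  have := norm_pos_iff.2 h.1
  positivity

theorem SNReachable.eps_pos {b₀ b : SNPoint T n} (h : D.SNReachable S b₀ b) (hb₀ : 0 < b₀.eps) :
    0 < b.eps := by
  induction h with
  | refl => exact hb₀
  | tail _ h ih => exact SNStep.eps_pos D S h ih

theorem armijo_coeff_pos : 0 < 2 * S.σ * (1 - S.delta) :=
  mul_pos (mul_pos two_pos S.σ_mem.1) (by linarith [S.delta_lt])

theorem SNStep.merit_le {b b' : SNPoint T n} (h : D.SNStep S b b') :
    D.merit S b' ≤ D.merit S b := by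
  obtain ⟨-, d, l, -, hl, rfl⟩ := h
  refine hl.1.trans (mul_le_of_le_one_left (sq_nonneg _) ?_)
  have := mul_pos (armijo_coeff_pos S) (pow_pos S.ρ_mem.1 l)
  linarith

/-! ### Accumulation points and infinite sequences -/

variable {D S} in
theorem IsSNSequence.reachable {b₀ : SNPoint T n} {s : ℕ → SNPoint T n}
    (hs : D.IsSNSequence S b₀ s) (k : ℕ) : D.SNReachable S b₀ (s k) := by
  induction k with
  | zero => rw [hs.1]; exact Relation.ReflTransGen.refl
  | succ k ih => exact ih.tail (hs.2 k)

theorem continuous_merit : Continuous (D.merit S) := (D.continuous_smoothEHat S).norm.pow 2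

/-- The merit values decrease along a sequence, and the value at an accumulation point is their
limit, hence a lower bound. -/
theorem merit_le_of_mapClusterPt {b₀ : SNPoint T n} {s : ℕ → SNPoint T n}
    (hs : D.IsSNSequence S b₀ s) {b : SNPoint T n} (hb : MapClusterPt b atTop s) (k : ℕ) :
    D.merit S b ≤ D.merit S (s k) := by
  have hanti : Antitone fun k => D.merit S (s k) :=
    antitone_nat_of_succ_le fun k => SNStep.merit_le D S (hs.2 k)
  by_contra! hlt
  have h1 := mapClusterPt_iff_frequently.1 hb _
    ((D.continuous_merit S).continuousAt.eventually_const_lt hlt)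
  obtain ⟨j, hj, hkj⟩ := (h1.and_eventually (eventually_ge_atTop k)).exists
  exact absurd (hanti hkj) (not_le.2 hj)

/-- Unless it solves the system, an accumulation point has a positive smoothing parameter: `ζ` is
bounded away from zero along the sequence, and with it the parameter. -/
theorem eps_pos_of_mapClusterPt {b₀ : SNPoint T n} (hb₀ : 0 < b₀.eps) {s : ℕ → SNPoint T n}
    (hs : D.IsSNSequence S b₀ s) {b : SNPoint T n} (hb : MapClusterPt b atTop s)
    (hne : D.smoothEHat S b ≠ 0) : 0 < b.eps := by
  have hN : 0 < ‖D.smoothEHat S b‖ := norm_pos_iff.2 hne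
  have hζ : 0 < D.zeta S b := mul_pos S.r_mem.1 (by positivity)
  have hζk : ∀ k, D.zeta S b ≤ D.zeta S (s k) := fun k => by
    have h : ‖D.smoothEHat S b‖ ≤ ‖D.smoothEHat S (s k)‖ :=
      abs_le_of_sq_le_sq' (D.merit_le_of_mapClusterPt S hs hb k) (norm_nonneg _) |>.2
    have := S.τ_mem.1
    have := S.r_mem.1
    unfold zeta
    gcongr
  set m := min b₀.eps (D.zeta S b * S.epsHat) with hm
  have hm0 : 0 < m := lt_min hb₀ (mul_pos hζ S.epsHat_pos)
  have hk : ∀ k, m ≤ (s k).eps := fun k => by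
    induction k with
    | zero => rw [hs.1]; exact min_le_left _ _
    | succ k ih =>
      refine le_trans (le_min ih ((min_le_right _ _).trans ?_)) (SNStep.min_le_eps D S (hs.2 k))
      exact mul_le_mul_of_nonneg_right (hζk k) S.epsHat_pos.le
  by_contra! hlt
  obtain ⟨j, hj⟩ := (mapClusterPt_iff_frequently.1 hb _
    (SNPoint.contDiff_eps.continuous.continuousAt.eventually_lt_const
      (lt_of_le_of_lt hlt hm0))).exists
  exact absurd (hk j) (not_le.2 hj)

/-- Suppose that an accumulation point `b` does not solve the system. It has `ε > 0`, hence is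
regular, so admissible directions from nearby points are bounded and the step sizes of nearby
iterates stay away from zero. One such step from an iterate close enough to `b` brings the merit
function below its value at `b`, which bounds it from below along the sequence. -/
theorem smoothEHat_eq_zero_of_mapClusterPt {b₀ : SNPoint T n} (hb₀ : 0 < b₀.eps)
    {s : ℕ → SNPoint T n} (hs : D.IsSNSequence S b₀ s) {b : SNPoint T n}
    (hb : MapClusterPt b atTop s) (hz : 0 < D.z b.mu b.C b.w) : D.smoothEHat S b = 0 := by
  by_contra hne
  have he := D.eps_pos_of_mapClusterPt S hb₀ hs hb hne
  have hr : D.SNRegular S b := by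
    refine ⟨?_, by linarith [mul_pos S.κ_pos he]⟩
    -- a singular `P` has inverse `0` in Mathlib, which would make `z` vanish
    by_contra hP
    rw [z, Matrix.nonsing_inv_apply_not_isUnit _ hP] at hz
    simp at hz
  obtain ⟨K, hK, hbound⟩ := exists_bound_of_injective_fderiv
    (D.contDiffAt_smoothEHat S he.ne') (D.injective_fderiv_smoothEHat S he hr)
  -- admissible directions `d` satisfy `‖Ê' d‖ ≤ (1 + δ) ‖Ê‖`, and `‖Ê‖` is bounded near `b`
  set N := ‖D.smoothEHat S b‖ + 1 with hN
  obtain ⟨l, hl⟩ := D.exists_uniform_trial S he.ne' (K * (2 * N))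
  have hNb : ∀ᶠ x in 𝓝 b, ‖D.smoothEHat S x‖ < N :=
    (D.continuous_smoothEHat S).norm.continuousAt.eventually_lt_const (by linarith)
  set c := 2 * S.σ * (1 - S.delta) * S.ρ ^ l with hc
  have hc0 : 0 < c := mul_pos (armijo_coeff_pos S) (pow_pos S.ρ_mem.1 l)
  have hmerit : 0 < D.merit S b := by
    have := norm_pos_iff.2 hne
    unfold merit
    positivity
  have hdec : ∀ᶠ x in 𝓝 b, (1 - c) * D.merit S x < D.merit S b :=
    ((D.continuous_merit S).const_mul (1 - c)).continuousAt.eventually_lt_const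
      (by nlinarith)
  obtain ⟨k, ⟨hk1, hk2⟩, hk3, hk4⟩ := (mapClusterPt_iff_frequently.1 hb _
    ((hbound.and hl).and (hNb.and hdec))).exists
  have hmono := D.merit_le_of_mapClusterPt S hs hb (k + 1)
  have hek := SNReachable.eps_pos D S (hs.reachable k) hb₀
  obtain ⟨-, d, j, hd, hj, hstep⟩ := hs.2 k
  have hdM : ‖d‖ ≤ K * (2 * N) := by
    refine (hk1 d).trans (mul_le_mul_of_nonneg_left ?_ hK.le)
    have h1 := D.norm_newton_residual_le S hek.ne' hd
    have h2 := norm_sub_le (D.smoothEHat S (s k) + fderiv ℝ (D.smoothEHat S) (s k) d)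
      (D.smoothEHat S (s k))
    rw [add_sub_cancel_left] at h2
    have h3 : S.delta * ‖D.smoothEHat S (s k)‖ ≤ ‖D.smoothEHat S (s k)‖ :=
      mul_le_of_le_one_left (norm_nonneg _) S.delta_lt.le
    linarith
  have hjl : j ≤ l := hj.2 (hk2 d hdM hd)
  have hρ : S.ρ ^ l ≤ S.ρ ^ j := pow_le_pow_of_le_one S.ρ_mem.1.le S.ρ_mem.2.le hjl
  have hle : D.merit S (s (k + 1)) ≤ (1 - c) * D.merit S (s k) := by
    rw [hstep]
    refine hj.1.trans (mul_le_mul_of_nonneg_right ?_ (sq_nonneg _))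
    rw [hc]
    have := mul_le_mul_of_nonneg_left hρ (armijo_coeff_pos S).le
    linarith
  linarith

theorem exists_isSNSequence_of_step {b₀ : SNPoint T n}
    (h : ∀ b, D.SNReachable S b₀ b → ∃ b', D.SNStep S b b') (N : ℕ) (t : ℕ → SNPoint T n)
    (ht0 : t 0 = b₀) (ht : ∀ k < N, D.SNStep S (t k) (t (k + 1))) :
    ∃ s, D.IsSNSequence S b₀ s ∧ ∀ k ≤ N, s k = t k := by
  choose! next hnext using h
  -- follow the given run up to index `N` and then a choice of steps
  let s : ℕ → SNPoint T n := fun k =>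
    Nat.rec b₀ (fun k b => if k < N then t (k + 1) else next b) k
  have hs1 : ∀ k, s (k + 1) = if k < N then t (k + 1) else next (s k) := fun k => rfl
  have hst : ∀ k ≤ N, s k = t k := by
    rintro (_ | k) hk
    · exact ht0.symm
    · rw [hs1, if_pos (Nat.lt_of_succ_le hk)]
  have hstep : ∀ k, D.SNReachable S b₀ (s k) → D.SNStep S (s k) (s (k + 1)) := fun k hk => by
    by_cases hkN : k < N
    · rw [hst k hkN.le, hst (k + 1) hkN]
      exact ht k hkN
    · rw [hs1, if_neg hkN]
      exact hnext _ hk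
  have hreach : ∀ k, D.SNReachable S b₀ (s k) := fun k => by
    induction k with
    | zero => exact Relation.ReflTransGen.refl
    | succ k ih => exact ih.tail (hstep k ih)
  exact ⟨s, ⟨rfl, fun k => hstep k (hreach k)⟩, hst⟩

end CVData

theorem mainTheorem2 {T n m₁ m₂ : ℕ} (D : CVData T n m₁ m₂) (S : SNParams)
    (b₀ : SNPoint T n) (hb₀ : 0 < b₀.eps) :
    -- the operations of SN at its iterates
    (∀ b, D.SNReachable S b₀ b →
      0 < b.eps ∧ D.smoothEHat S b ≠ 0 ∧ DifferentiableAt ℝ (D.smoothEHat S) b ∧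
      (D.SNRegular S b →
        Function.Bijective (fderiv ℝ (D.smoothEHat S) b) ∧ ∃ Δ, D.IsSNDirection S b Δ) ∧
      (∀ Δ, D.IsSNDirection S b Δ → ∃ l, D.IsSNStepSize S b Δ l)) ∧
    -- no run of SN ends: each finite run extends to an infinite sequence
    ((∀ b, D.SNReachable S b₀ b → D.SNRegular S b) →
      ∀ (N : ℕ) (t : ℕ → SNPoint T n), t 0 = b₀ →
        (∀ k < N, D.SNStep S (t k) (t (k + 1))) →
        ∃ s, D.IsSNSequence S b₀ s ∧ ∀ k ≤ N, s k = t k) ∧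
    -- accumulation points
    (∀ s, D.IsSNSequence S b₀ s →
      ∀ b : SNPoint T n, MapClusterPt b atTop s → 0 < D.z b.mu b.C b.w →
        D.smoothEHat S b = 0 ∧ b.eps = 0) := by
  refine ⟨fun b hb => ?_, fun hreg N t ht0 ht => ?_, fun s hs b hb hz => ?_⟩
  · have he := CVData.SNReachable.eps_pos D S hb hb₀
    exact ⟨he, D.smoothEHat_ne_zero S he.ne',
      (D.contDiffAt_smoothEHat S he.ne').differentiableAt one_ne_zero,
      fun hr => ⟨D.bijective_fderiv_smoothEHat S he hr, D.exists_isSNDirection S he hr⟩,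
      fun Δ hΔ => D.exists_isSNStepSize S he.ne' hΔ⟩
  · exact D.exists_isSNSequence_of_step S
      (fun b hb => D.exists_snStep S (CVData.SNReachable.eps_pos D S hb hb₀) (hreg b hb)) N t ht0 ht
  · have h := D.smoothEHat_eq_zero_of_mapClusterPt S hb₀ hs hb hz
    exact ⟨h, by rw [← D.eps_smoothEHat S, h]; rfl⟩
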